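/- Let $\rho_1(u)=\frac{\pi}{2}\,\mathrm{sech}^2(\pi u)$ for $u\in\mathbb{R}$ and, for $\ell\ge 2$, let $\rho_\ell(u)=\int_{-\infty}^{\infty}\rho_{\ell-1}(v)\,\rho_1(u-v)\,dv$ be its $\ell$-fold convolution. Let $\psi=\Gamma'/\Gamma$ be the digamma function, $H_r=\sum_{k=1}^{r}\frac1k$ the $r$-th harmonic number (with $H_0=0$), and $\binom{t}{r}=\frac{t(t-1)\cdots(t-r+1)}{r!}$ for $t\in\mathbb{R}$. Theorem. Let $\ell\ge 1$ be an integer, let $x$ be a real number with $x>\ell/2$, and put $b=(x-\ell/2)^{-2}$. Then the integral below converges absolutely, the function in braces is $\ell-1$ times continuously differentiable near $x$, and $$\int_{0}^{\infty}\log(1+bu^{2})\,\rho_\ell(u)\,du=-\log\left|x-\frac{\ell}{2}\right|-H_{\ell-1}+\frac{d^{\ell-1}}{dx^{\ell-1}}\left\{\binom{x-1}{\ell-1}\,\psi\!\left(x-\left\lfloor\frac{\ell}{2}\right\rfloor\right)\right\}.$$ -/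

import Mathlib

/-- The density `ρ(x) = (π / 2) sech² (π x)`. -/
noncomputable def sechDensity (x : ℝ) : ℝ :=
  Real.pi / 2 * (1 / Real.cosh (Real.pi * x)) ^ 2

/-- `rho ℓ` is the `ℓ`-fold convolution of `sechDensity` with itself (`ℓ ≥ 1`); the value at
`ℓ = 0` is a placeholder that is never used. -/
noncomputable def rho : ℕ → ℝ → ℝ
  | 0 => fun _ => 0
  | 1 => sechDensity
  | n + 2 => fun x => ∫ u : ℝ, rho (n + 1) u * sechDensity (x - u)

/-- The digamma function `ψ = Γ' / Γ` on the real line. -/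
noncomputable def realDigamma (x : ℝ) : ℝ := logDeriv Real.Gamma x

/-- Away from the poles of `Γ`, `realDigamma` is the derivative of `log |Γ|`. -/
theorem realDigamma_eq_deriv_log {x : ℝ} (hx : ∀ m : ℕ, x ≠ -m) :
    realDigamma x = deriv (fun t => Real.log (Real.Gamma t)) x := by
  have hd : DifferentiableAt ℝ Real.Gamma x := Real.differentiableAt_Gamma hx
  rw [deriv.log hd (Real.Gamma_ne_zero hx)]
  rfl

/-- Away from the poles of `Γ`, `realDigamma` is the restriction of the complex digamma
function. -/
theorem ofReal_realDigamma {x : ℝ} (hx : ∀ m : ℕ, x ≠ -m) :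
    (realDigamma x : ℂ) = Complex.digamma x := by
  have hx' : ∀ m : ℕ, (x : ℂ) ≠ -m := fun m h => hx m (by exact_mod_cast h)
  have h1 : HasDerivAt Complex.Gamma (deriv Complex.Gamma x) (x : ℂ) :=
    (Complex.differentiableAt_Gamma _ hx').hasDerivAt
  have h2 := h1.comp_ofReal
  have h3 : HasDerivAt (fun t : ℝ => ((Real.Gamma t : ℝ) : ℂ))
      ((deriv Real.Gamma x : ℝ) : ℂ) x :=
    (Real.differentiableAt_Gamma hx).hasDerivAt.ofReal_comp
  have h4 : deriv Complex.Gamma x = ((deriv Real.Gamma x : ℝ) : ℂ) := by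
    refine h2.unique ?_
    simpa only [Complex.Gamma_ofReal] using h3
  rw [Complex.digamma_def, logDeriv_apply, h4, Complex.Gamma_ofReal, realDigamma, logDeriv_apply,
    Complex.ofReal_div]

open MeasureTheory Filter Set
open scoped Topology

/-! Write `a = x - ℓ/2`. Since `ρ_ℓ` is even with mass 1, the integral plus `log a` is the potential
`∫ log|a + iu| ρ_ℓ(u) du`. Its derivative in `a` is a Poisson integral, that is, the Laplace
transform of the Fourier transform of `ρ_ℓ`, which is `((t/2)/sinh(t/2))^ℓ` by the Beta integral. In
the variable `x` this becomes `L_ℓ(x) = ∫₀^∞ e^{-xt} T(t)^ℓ dt` with `T(t) = t/(1 - e^{-t})`.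

The Riccati equation `t T' = (1 + t) T - T²` relates `L_{n+1}` to `L_n` and `L_n'`
(`toddLaplace_succ`). Integrating, with constants fixed at infinity where each potential is `log x +
o(1)`, gives a first-order recursion for the potentials (`toddPotential_succ`), whose constants add
up to the harmonic number. For `ℓ = 1` the potential is `ψ`, by its difference equation and
asymptotics. The Leibniz rule shows that the derivatives of binomial times `ψ` obey the same
recursion (`toddPotential_eq`). Shifting the argument of `ψ` by an integer at most `ℓ - 1` only adds
a polynomial killed by `ℓ - 1` derivatives. -/

/-! ### Fourier transform of the density, via the Beta integral -/

theorem hasDerivAt_sigmoid_two_pi_mul (u : ℝ) :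
    HasDerivAt (fun u : ℝ => Real.sigmoid (2 * Real.pi * u)) (sechDensity u) u := by
  have h := (Real.hasDerivAt_sigmoid (2 * Real.pi * u)).comp u
    ((hasDerivAt_id u).const_mul (2 * Real.pi))
  refine h.congr_deriv ?_
  have e1 : Real.exp (-(2 * Real.pi * u)) = Real.exp (-(Real.pi * u)) * Real.exp (-(Real.pi * u)) := by
    rw [← Real.exp_add]; congr 1; ring
  have e2 : Real.exp (Real.pi * u) = (Real.exp (-(Real.pi * u)))⁻¹ := by
    rw [Real.exp_neg, inv_inv]
  rw [Real.sigmoid_def, sechDensity, Real.cosh_eq, e1, e2]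
  have hE := Real.exp_pos (-(Real.pi * u))
  set E := Real.exp (-(Real.pi * u))
  have h1 : 1 + E * E ≠ 0 := by positivity
  have h2 : E⁻¹ + E ≠ 0 := by positivity
  field_simp
  ring

theorem sechDensity_pos (u : ℝ) : 0 < sechDensity u := by
  unfold sechDensity
  have := Real.cosh_pos (Real.pi * u)
  positivity

theorem sechDensity_neg (u : ℝ) : sechDensity (-u) = sechDensity u := by
  simp [sechDensity]

theorem image_sigmoid_two_pi_mul :
    (fun u : ℝ => Real.sigmoid (2 * Real.pi * u)) '' univ = Ioo 0 1 := by
  rw [← Real.range_sigmoid, image_univ]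
  have : Function.Surjective (fun u : ℝ => 2 * Real.pi * u) :=
    mul_left_surjective₀ (by positivity)
  exact this.range_comp Real.sigmoid

/-- `σ/(1 - σ) = e^y`, so the substitution by the sigmoid turns the integrand of `B(1 + s, 1 - s)`
into an exponential. -/
theorem cpow_sigmoid_mul_cpow (s : ℂ) (y : ℝ) :
    (Real.sigmoid y : ℂ) ^ s * (1 - (Real.sigmoid y : ℂ)) ^ (-s) = Complex.exp (s * y) := by
  have h0 := Real.sigmoid_pos y
  have h1 : 0 < 1 - Real.sigmoid y := sub_pos.2 (Real.sigmoid_lt_one y)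
  have hlog : Real.log (Real.sigmoid y) - Real.log (1 - Real.sigmoid y) = y := by
    have : Real.sigmoid y = (1 - Real.sigmoid y) * Real.exp y := by
      rw [← Real.sigmoid_neg, ← Real.sigmoid_mul_rexp_neg, mul_assoc, ← Real.exp_add]
      simp
    nth_rewrite 1 [this]
    rw [Real.log_mul h1.ne' (Real.exp_ne_zero _), Real.log_exp]
    ring
  have h1c : (1 - (Real.sigmoid y : ℂ)) = ((1 - Real.sigmoid y : ℝ) : ℂ) := by push_cast; rfl
  rw [h1c, Complex.cpow_def_of_ne_zero (by exact_mod_cast h0.ne'),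
    Complex.cpow_def_of_ne_zero (by exact_mod_cast h1.ne'), ← Complex.exp_add,
    ← Complex.ofReal_log h0.le, ← Complex.ofReal_log h1.le]
  congr 1
  rw [← hlog]
  simp only [hlog]
  rw [← Complex.ofReal_inj] at hlog
  push_cast at hlog ⊢
  linear_combination s * hlog

theorem integrable_exp_mul_sechDensity {s : ℂ} (h1 : -1 < s.re) (h2 : s.re < 1) :
    Integrable (fun u : ℝ => Complex.exp (s * (2 * Real.pi * u : ℝ)) * (sechDensity u : ℂ)) := by
  have hb := Complex.betaIntegral_convergent (u := 1 + s) (v := 1 - s)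
    (by simp; linarith) (by simp; linarith)
  rw [intervalIntegrable_iff_integrableOn_Ioo_of_le zero_le_one, ← image_sigmoid_two_pi_mul,
    integrableOn_image_iff_integrableOn_abs_deriv_smul MeasurableSet.univ
      (fun u _ => (hasDerivAt_sigmoid_two_pi_mul u).hasDerivWithinAt)
      ((Real.sigmoid_injective.comp (mul_right_injective₀ (by positivity))).injOn),
    integrableOn_univ] at hb
  refine hb.congr (ae_of_all _ fun u => ?_)
  simp only [add_sub_cancel_left, show (1 - s - 1 : ℂ) = -s by ring, cpow_sigmoid_mul_cpow,
    abs_of_pos (sechDensity_pos u), Complex.real_smul]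
  ring

/-- This is `B(1 + s, 1 - s) = s Γ(s) Γ(1 - s)`, evaluated by the reflection formula. -/
theorem integral_exp_mul_sechDensity {s : ℂ} (h1 : -1 < s.re) (h2 : s.re < 1) (hs : s ≠ 0) :
    ∫ u : ℝ, Complex.exp (s * (2 * Real.pi * u : ℝ)) * (sechDensity u : ℂ) =
      Real.pi * s / Complex.sin (Real.pi * s) := by
  have hb := Complex.betaIntegral_eq_Gamma_mul_div (1 + s) (1 - s)
    (by simp; linarith) (by simp; linarith)
  rw [Complex.betaIntegral, intervalIntegral.integral_of_le zero_le_one, integral_Ioc_eq_integral_Ioo,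
    ← image_sigmoid_two_pi_mul,
    integral_image_eq_integral_abs_deriv_smul MeasurableSet.univ
      (fun u _ => (hasDerivAt_sigmoid_two_pi_mul u).hasDerivWithinAt)
      ((Real.sigmoid_injective.comp (mul_right_injective₀ (by positivity))).injOn),
    setIntegral_univ, show (1 + s + (1 - s) : ℂ) = 1 + 1 by ring, Complex.Gamma_add_one _ one_ne_zero,
    Complex.Gamma_one, add_comm 1 s, Complex.Gamma_add_one _ hs, mul_assoc,
    Complex.Gamma_mul_Gamma_one_sub] at hb
  calc _ = _ := integral_congr_ae (ae_of_all _ fun u => ?_)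
    _ = _ := hb
    _ = _ := by ring
  simp only [add_sub_cancel_right, show (1 - s - 1 : ℂ) = -s by ring, cpow_sigmoid_mul_cpow,
    abs_of_pos (sechDensity_pos u), Complex.real_smul]
  ring

/-- The function `(t / 2) / sinh (t / 2)`, the Fourier transform of `sechDensity`. -/
noncomputable def divSinh (t : ℝ) : ℝ := (t / 2) / Real.sinh (t / 2)

/-- Rescaled, the strip of convergence is `|Re s| < 2π`; the part kept contains the imaginary axis
for the Fourier transform and `±1` for the moment bounds. -/
theorem integrable_cexp_mul_sechDensity {s : ℂ} (h1 : -1 ≤ s.re) (h2 : s.re ≤ 1) :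
    Integrable (fun u : ℝ => Complex.exp (s * u) * (sechDensity u : ℂ)) := by
  have hp := Real.pi_gt_three
  have hre : (s / (2 * Real.pi : ℝ)).re = s.re / (2 * Real.pi) := Complex.div_ofReal_re _ _
  have h := integrable_exp_mul_sechDensity (s := s / (2 * Real.pi : ℝ))
    (by rw [hre, lt_div_iff₀ (by positivity)]; linarith)
    (by rw [hre, div_lt_iff₀ (by positivity)]; linarith)
  refine h.congr (ae_of_all _ fun u => ?_)
  have : (Real.pi : ℂ) ≠ 0 := by exact_mod_cast Real.pi_ne_zero
  simp only
  congr 2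
  push_cast
  field_simp

theorem integral_cexp_mul_I_mul_sechDensity {t : ℝ} (ht : 0 < t) :
    ∫ u : ℝ, Complex.exp (t * Complex.I * u) * (sechDensity u : ℂ) = (divSinh t : ℂ) := by
  have hpi : (Real.pi : ℂ) ≠ 0 := by exact_mod_cast Real.pi_ne_zero
  have htc : (t : ℂ) ≠ 0 := by exact_mod_cast ht.ne'
  have hre : (t * Complex.I / (2 * Real.pi : ℝ)).re = 0 := by
    rw [Complex.div_ofReal_re]; simp
  have h := integral_exp_mul_sechDensity (s := t * Complex.I / (2 * Real.pi : ℝ))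
    (by rw [hre]; norm_num) (by rw [hre]; norm_num) 
    (div_ne_zero (mul_ne_zero htc Complex.I_ne_zero)
      (by exact_mod_cast (by positivity : 2 * Real.pi ≠ 0)))
  have e : (Real.pi : ℂ) * (t * Complex.I / (2 * Real.pi : ℝ)) = (t / 2 : ℂ) * Complex.I := by
    push_cast; field_simp
  rw [e, Complex.sin_mul_I, mul_div_mul_right _ _ Complex.I_ne_zero] at h
  rw [divSinh]
  push_cast
  rw [← h]
  refine integral_congr_ae (ae_of_all _ fun u => ?_)
  simp only
  congr 2
  push_cast
  field_simp

/-! ### Convolution powers: symmetry, transforms, moments -/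

theorem rho_add_two (n : ℕ) (x : ℝ) :
    rho (n + 2) x = ∫ u : ℝ, rho (n + 1) u * sechDensity (x - u) := rfl

theorem rho_succ_nonneg (n : ℕ) (x : ℝ) : 0 ≤ rho (n + 1) x := by
  induction n generalizing x with
  | zero => exact (sechDensity_pos x).le
  | succ n ih =>
    rw [rho_add_two]
    exact integral_nonneg fun u => mul_nonneg (ih u) (sechDensity_pos _).le

theorem rho_succ_neg (n : ℕ) (x : ℝ) : rho (n + 1) (-x) = rho (n + 1) x := by
  induction n generalizing x with
  | zero => exact sechDensity_neg x
  | succ n ih =>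
    rw [rho_add_two, rho_add_two, ← integral_neg_eq_self]
    refine integral_congr_ae (ae_of_all _ fun u => ?_)
    simp only
    rw [ih, ← sechDensity_neg (x - u)]
    congr 2
    ring

/-- Exponentials are characters, so twisting by one commutes with convolution; hence integrability
and transforms pass to the powers. -/
theorem cexp_mul_rho_add_two (s : ℂ) (n : ℕ) :
    (fun x : ℝ => Complex.exp (s * x) * (rho (n + 2) x : ℂ)) =
      convolution (fun u : ℝ => Complex.exp (s * u) * (rho (n + 1) u : ℂ))
        (fun u : ℝ => Complex.exp (s * u) * (sechDensity u : ℂ)) (ContinuousLinearMap.mul ℝ ℂ) := by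
  ext x
  rw [rho_add_two, convolution, ← integral_complex_ofReal, ← integral_const_mul]
  refine integral_congr_ae (ae_of_all _ fun u => ?_)
  have : Complex.exp (s * x) = Complex.exp (s * u) * Complex.exp (s * (x - u : ℝ)) := by
    rw [← Complex.exp_add]; congr 1; push_cast; ring
  simp only [ContinuousLinearMap.mul_apply', this]
  push_cast
  ring

theorem integrable_cexp_mul_rho {s : ℂ} (h1 : -1 ≤ s.re) (h2 : s.re ≤ 1) (n : ℕ) :
    Integrable (fun u : ℝ => Complex.exp (s * u) * (rho (n + 1) u : ℂ)) := by
  induction n with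
  | zero => exact integrable_cexp_mul_sechDensity h1 h2
  | succ n ih =>
    rw [cexp_mul_rho_add_two]
    exact ih.integrable_convolution _ (integrable_cexp_mul_sechDensity h1 h2)

theorem integral_cexp_mul_rho {s : ℂ} (h1 : -1 ≤ s.re) (h2 : s.re ≤ 1) (n : ℕ) :
    ∫ u : ℝ, Complex.exp (s * u) * (rho (n + 1) u : ℂ) =
      (∫ u : ℝ, Complex.exp (s * u) * (sechDensity u : ℂ)) ^ (n + 1) := by
  induction n with
  | zero => rw [zero_add, pow_one]; rfl
  | succ n ih =>
    rw [cexp_mul_rho_add_two, integral_convolution _ (integrable_cexp_mul_rho h1 h2 n)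
      (integrable_cexp_mul_sechDensity h1 h2), ih, ContinuousLinearMap.mul_apply', ← pow_succ]

theorem integral_cexp_mul_I_mul_rho {t : ℝ} (ht : 0 < t) (n : ℕ) :
    ∫ u : ℝ, Complex.exp (t * Complex.I * u) * (rho (n + 1) u : ℂ) = (divSinh t : ℂ) ^ (n + 1) := by
  rw [integral_cexp_mul_rho (by simp) (by simp), integral_cexp_mul_I_mul_sechDensity ht]

theorem integrable_exp_mul_rho {c : ℝ} (h1 : -1 ≤ c) (h2 : c ≤ 1) (n : ℕ) :
    Integrable (fun u : ℝ => Real.exp (c * u) * rho (n + 1) u) := by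
  refine (integrable_cexp_mul_rho (s := c) (by simpa) (by simpa) n).re.congr (ae_of_all _ fun u => ?_)
  beta_reduce
  rw [← Complex.ofReal_mul, ← Complex.ofReal_exp, ← Complex.ofReal_mul]
  exact Complex.ofReal_re _

theorem integrable_rho_succ (n : ℕ) : Integrable (rho (n + 1)) := by
  simpa using integrable_exp_mul_rho (c := 0) (by simp) (by simp) n

theorem integral_sechDensity : ∫ u, sechDensity u = 1 := by
  have h2 : 0 < 2 * Real.pi := by positivity
  have h := integral_of_hasDerivAt_of_tendsto hasDerivAt_sigmoid_two_pi_mul (integrable_rho_succ 0)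
    (Real.tendsto_sigmoid_atBot.comp (tendsto_id.const_mul_atBot h2))
    (Real.tendsto_sigmoid_atTop.comp (tendsto_id.const_mul_atTop h2))
  simpa using h

theorem integral_rho_succ (n : ℕ) : ∫ u, rho (n + 1) u = 1 := by
  have h := integral_cexp_mul_rho (s := 0) (by simp) (by simp) n
  simp only [zero_mul, Complex.exp_zero, one_mul, integral_complex_ofReal, integral_sechDensity,
    Complex.ofReal_one, one_pow] at h
  exact_mod_cast h

theorem sq_le_two_mul_exp_add_exp (u : ℝ) : u ^ 2 ≤ 2 * (Real.exp (1 * u) + Real.exp (-1 * u)) := by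
  have h := Real.quadratic_le_exp_of_nonneg (abs_nonneg u)
  have h1 : Real.exp |u| ≤ Real.exp (1 * u) + Real.exp (-1 * u) := by
    rcases abs_cases u with ⟨h, -⟩ | ⟨h, -⟩ <;> rw [h] <;>
      simp [Real.exp_nonneg]
  have := abs_nonneg u
  rw [sq_abs] at h
  linarith

theorem integrable_sq_mul_rho (n : ℕ) : Integrable (fun u : ℝ => u ^ 2 * rho (n + 1) u) := by
  refine (((integrable_exp_mul_rho (c := 1) (by simp) le_rfl n).add
    (integrable_exp_mul_rho (c := -1) le_rfl (by simp) n)).const_mul 2).mono' ?_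
    (ae_of_all _ fun u => ?_)
  · exact (by fun_prop : Continuous fun u : ℝ => u ^ 2).aestronglyMeasurable.mul
      (integrable_rho_succ n).aestronglyMeasurable
  · have hr := rho_succ_nonneg n u
    rw [Real.norm_of_nonneg (by positivity)]
    have := mul_le_mul_of_nonneg_right (sq_le_two_mul_exp_add_exp u) hr
    simp only [Pi.add_apply]
    linarith

/-! ### The logarithmic integral and its potential -/

theorem log_one_add_mul_sq_nonneg {b : ℝ} (hb : 0 ≤ b) (u : ℝ) : 0 ≤ Real.log (1 + b * u ^ 2) :=
  Real.log_nonneg (by nlinarith [mul_nonneg hb (sq_nonneg u)])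

theorem log_one_add_mul_sq_le {b : ℝ} (hb : 0 ≤ b) (u : ℝ) :
    Real.log (1 + b * u ^ 2) ≤ b * u ^ 2 := by
  have := Real.log_le_sub_one_of_pos (x := 1 + b * u ^ 2) (by positivity)
  linarith

theorem integrable_log_mul_rho {b : ℝ} (hb : 0 ≤ b) (n : ℕ) :
    Integrable (fun u : ℝ => Real.log (1 + b * u ^ 2) * rho (n + 1) u) := by
  refine ((integrable_sq_mul_rho n).const_mul b).mono' ?_ (ae_of_all _ fun u => ?_)
  · exact (by fun_prop : Measurable fun u : ℝ =>
      Real.log (1 + b * u ^ 2)).aestronglyMeasurable.mul (integrable_rho_succ n).aestronglyMeasurable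
  · have hr := rho_succ_nonneg n u
    rw [Real.norm_of_nonneg (mul_nonneg (log_one_add_mul_sq_nonneg hb u) hr), ← mul_assoc]
    exact mul_le_mul_of_nonneg_right (log_one_add_mul_sq_le hb u) hr

theorem integral_log_mul_rho_nonneg {b : ℝ} (hb : 0 ≤ b) (n : ℕ) :
    0 ≤ ∫ u, Real.log (1 + b * u ^ 2) * rho (n + 1) u :=
  integral_nonneg fun u => mul_nonneg (log_one_add_mul_sq_nonneg hb u) (rho_succ_nonneg n u)

theorem integral_log_mul_rho_le {b : ℝ} (hb : 0 ≤ b) (n : ℕ) :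
    ∫ u, Real.log (1 + b * u ^ 2) * rho (n + 1) u ≤ b * ∫ u, u ^ 2 * rho (n + 1) u := by
  rw [← integral_const_mul]
  refine integral_mono (integrable_log_mul_rho hb n) ((integrable_sq_mul_rho n).const_mul b)
    fun u => ?_
  simp only
  rw [← mul_assoc]
  exact mul_le_mul_of_nonneg_right (log_one_add_mul_sq_le hb u) (rho_succ_nonneg n u)

theorem integral_Ioi_log_mul_rho (b : ℝ) (n : ℕ) :
    ∫ u, Real.log (1 + b * u ^ 2) * rho (n + 1) u =
      2 * ∫ u in Ioi (0 : ℝ), Real.log (1 + b * u ^ 2) * rho (n + 1) u := by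
  rw [← integral_comp_abs (f := fun u => Real.log (1 + b * u ^ 2) * rho (n + 1) u)]
  refine integral_congr_ae (ae_of_all _ fun u => ?_)
  simp only [sq_abs]
  rcases abs_cases u with ⟨h, -⟩ | ⟨h, -⟩ <;> rw [h]
  rw [rho_succ_neg]

/-- The logarithmic potential `∫ log |a + i u| ρ_{n+1}(u) du`. -/
noncomputable def logPotential (n : ℕ) (a : ℝ) : ℝ :=
  ∫ u, 1 / 2 * Real.log (a ^ 2 + u ^ 2) * rho (n + 1) u

theorem half_log_sq_add_sq_mul_rho {a : ℝ} (ha : 0 < a) (n : ℕ) (u : ℝ) :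
    1 / 2 * Real.log (a ^ 2 + u ^ 2) * rho (n + 1) u = Real.log a * rho (n + 1) u +
      1 / 2 * (Real.log (1 + a ^ (-2 : ℤ) * u ^ 2) * rho (n + 1) u) := by
  have h : a ^ 2 + u ^ 2 = a ^ 2 * (1 + a ^ (-2 : ℤ) * u ^ 2) := by
    rw [zpow_neg]
    norm_cast
    field_simp
  have hp : 0 < 1 + a ^ (-2 : ℤ) * u ^ 2 := by positivity
  rw [h, Real.log_mul (by positivity) hp.ne', Real.log_pow]
  push_cast
  ring

theorem integrable_half_log_mul_rho {a : ℝ} (ha : 0 < a) (n : ℕ) :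
    Integrable fun u => 1 / 2 * Real.log (a ^ 2 + u ^ 2) * rho (n + 1) u := by
  simp_rw [half_log_sq_add_sq_mul_rho ha]
  exact ((integrable_rho_succ n).const_mul _).add
    ((integrable_log_mul_rho (by positivity) n).const_mul _)

theorem logPotential_eq {a : ℝ} (ha : 0 < a) (n : ℕ) :
    logPotential n a =
      Real.log a + 1 / 2 * ∫ u, Real.log (1 + a ^ (-2 : ℤ) * u ^ 2) * rho (n + 1) u := by
  simp_rw [logPotential, half_log_sq_add_sq_mul_rho ha]
  rw [integral_add ((integrable_rho_succ n).const_mul _)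
    ((integrable_log_mul_rho (by positivity) n).const_mul _), integral_const_mul,
    integral_const_mul, integral_rho_succ, mul_one]

theorem tendsto_logPotential_sub_log (n : ℕ) :
    Tendsto (fun a => logPotential n a - Real.log a) atTop (𝓝 0) := by
  have h0 : Tendsto (fun a : ℝ => 1 / 2 * (a ^ (-2 : ℤ) * ∫ u, u ^ 2 * rho (n + 1) u)) atTop (𝓝 0) := by
    have : Tendsto (fun a : ℝ => a ^ (-2 : ℤ)) atTop (𝓝 0) :=
      tendsto_zpow_atTop_zero (by norm_num)
    have h := (this.mul_const (∫ u, u ^ 2 * rho (n + 1) u)).const_mul (1 / 2)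
    rwa [zero_mul, mul_zero] at h
  refine tendsto_of_tendsto_of_tendsto_of_le_of_le' tendsto_const_nhds h0 ?_ ?_ <;>
    filter_upwards [eventually_gt_atTop 0] with a ha <;> rw [logPotential_eq ha]
  · have := integral_log_mul_rho_nonneg (b := a ^ (-2 : ℤ)) (by positivity) n
    linarith
  · have := integral_log_mul_rho_le (b := a ^ (-2 : ℤ)) (by positivity) n
    linarith

theorem hasDerivAt_logPotential_integral (n : ℕ) {a : ℝ} (ha : 0 < a) :
    HasDerivAt (logPotential n) (∫ u, a / (a ^ 2 + u ^ 2) * rho (n + 1) u) a := by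
  have hm := (integrable_rho_succ n).aestronglyMeasurable
  refine (hasDerivAt_integral_of_dominated_loc_of_deriv_le (s := Ioi (a / 2))
    (F := fun a u => 1 / 2 * Real.log (a ^ 2 + u ^ 2) * rho (n + 1) u)
    (F' := fun a u => a / (a ^ 2 + u ^ 2) * rho (n + 1) u)
    (bound := fun u => 2 / a * rho (n + 1) u) (Ioi_mem_nhds (by linarith)) ?_
    (integrable_half_log_mul_rho ha n) ?_ ?_ ((integrable_rho_succ n).const_mul _) ?_).2
  · exact Eventually.of_forall fun c => (by fun_prop : Measurable fun u : ℝ =>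
      1 / 2 * Real.log (c ^ 2 + u ^ 2)).aestronglyMeasurable.mul hm
  · exact (by fun_prop : Measurable fun u : ℝ => a / (a ^ 2 + u ^ 2)).aestronglyMeasurable.mul hm
  · refine ae_of_all _ fun u c hc => ?_
    have hc : a / 2 < c := hc
    have hc0 : 0 < c := by linarith
    have hr := rho_succ_nonneg n u
    rw [Real.norm_of_nonneg (by positivity)]
    refine mul_le_mul_of_nonneg_right ?_ hr
    -- `c / (c² + u²) ≤ 1/c < 2/a` for `c > a/2`.
    rw [div_le_div_iff₀ (by positivity) ha]
    nlinarith [sq_nonneg u]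
  · refine ae_of_all _ fun u c hc => ?_
    have hc : a / 2 < c := hc
    have hc0 : 0 < c := by linarith
    have h := ((((hasDerivAt_id c).pow 2).add_const (u ^ 2)).log (by simp; positivity)).const_mul
      (1 / 2) |>.mul_const (rho (n + 1) u)
    refine h.congr_deriv ?_
    simp only [id_eq, Pi.pow_apply, Nat.cast_ofNat, Nat.add_one_sub_one, pow_one, mul_one]
    ring

/-! ### The derivative of the potential as a Laplace transform -/

theorem integral_Ioi_cexp_re {a : ℝ} (ha : 0 < a) (u : ℝ) :
    (∫ t in Ioi (0 : ℝ), Complex.exp ((-a + u * Complex.I) * t)).re = a / (a ^ 2 + u ^ 2) := by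
  rw [integral_exp_mul_complex_Ioi (by simpa)]
  simp [Complex.div_re, Complex.normSq_apply]
  ring_nf

/-- Justifies Fubini: the modulus is the product `e^{-at} ρ(u)`. -/
theorem integrable_laplace_prod {a : ℝ} (ha : 0 < a) (n : ℕ) :
    Integrable (fun p : ℝ × ℝ =>
      Complex.exp ((-a + p.1 * Complex.I) * p.2) * (rho (n + 1) p.1 : ℂ))
      (volume.prod (volume.restrict (Ioi 0))) := by
  have h : Integrable (fun p : ℝ × ℝ => (rho (n + 1) p.1 : ℂ) * Complex.exp (-a * p.2))
      (volume.prod (volume.restrict (Ioi 0))) :=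
    (integrable_rho_succ n).ofReal.mul_prod (integrableOn_exp_mul_complex_Ioi (by simpa) 0)
  refine (h.bdd_mul (c := 1) (f := fun p : ℝ × ℝ => Complex.exp ((p.1 * p.2 : ℝ) * Complex.I))
    (by fun_prop : Continuous _).aestronglyMeasurable (ae_of_all _ fun p => ?_)).congr
    (ae_of_all _ fun p => ?_)
  · rw [Complex.norm_exp_ofReal_mul_I]
  · have : Complex.exp ((-a + p.1 * Complex.I) * p.2) =
      Complex.exp (-a * p.2) * Complex.exp ((p.1 * p.2 : ℝ) * Complex.I) := by
      rw [← Complex.exp_add]; congr 1; push_cast; ring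
    simp only [this]
    ring

theorem integral_poisson_mul_rho {a : ℝ} (ha : 0 < a) (n : ℕ) :
    ∫ u, a / (a ^ 2 + u ^ 2) * rho (n + 1) u =
      ∫ t in Ioi (0 : ℝ), Real.exp (-a * t) * divSinh t ^ (n + 1) := by
  have hI := integrable_laplace_prod ha n
  have h := integral_integral_swap (f := fun u t : ℝ =>
    Complex.exp ((-a + u * Complex.I) * t) * (rho (n + 1) u : ℂ)) hI
  have hr : ∀ t ∈ Ioi (0 : ℝ), ∫ u : ℝ, Complex.exp ((-a + u * Complex.I) * t) *
      (rho (n + 1) u : ℂ) = ((Real.exp (-a * t) * divSinh t ^ (n + 1) : ℝ) : ℂ) := by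
    intro t ht
    push_cast
    rw [← integral_cexp_mul_I_mul_rho ht, ← integral_const_mul]
    refine integral_congr_ae (ae_of_all _ fun u => ?_)
    simp only
    rw [← mul_assoc, ← Complex.exp_add]
    congr 2
    ring
  rw [setIntegral_congr_fun measurableSet_Ioi hr, integral_complex_ofReal] at h
  rw [← Complex.ofReal_re (∫ t in Ioi (0 : ℝ), Real.exp (-a * t) * divSinh t ^ (n + 1)), ← h]
  have h2 := hI.integral_prod_left
  have h3 := integral_re h2
  refine Eq.trans (integral_congr_ae (ae_of_all _ fun u => ?_)) h3
  simp only
  rw [integral_mul_const]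
  change _ = Complex.re _
  rw [Complex.re_mul_ofReal, integral_Ioi_cexp_re ha]

theorem hasDerivAt_logPotential (n : ℕ) {a : ℝ} (ha : 0 < a) :
    HasDerivAt (logPotential n)
      (∫ t in Ioi (0 : ℝ), Real.exp (-a * t) * divSinh t ^ (n + 1)) a :=
  integral_poisson_mul_rho ha n ▸ hasDerivAt_logPotential_integral n ha

/-! ### Powers of the Todd function and their Laplace transforms -/

/-- The Todd function `t / (1 - e⁻ᵗ)`. -/
noncomputable def toddFun (t : ℝ) : ℝ := t / (1 - Real.exp (-t))

theorem one_sub_exp_neg_pos {t : ℝ} (ht : 0 < t) : 0 < 1 - Real.exp (-t) := by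
  have := Real.exp_lt_one_iff.2 (neg_lt_zero.2 ht)
  linarith

theorem toddFun_eq {t : ℝ} (ht : 0 < t) : toddFun t = Real.exp (t / 2) * divSinh t := by
  have h0 := one_sub_exp_neg_pos ht
  have h1 : 0 < Real.sinh (t / 2) := Real.sinh_pos_iff.2 (by linarith)
  rw [toddFun, divSinh, ← mul_div_assoc, div_eq_div_iff h0.ne' h1.ne', Real.sinh_eq]
  have e1 : Real.exp (-t) = Real.exp (-(t / 2)) * Real.exp (-(t / 2)) := by
    rw [← Real.exp_add]; congr 1; ring
  have e2 : Real.exp (t / 2) * Real.exp (-(t / 2)) = 1 := by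
    rw [← Real.exp_add]; simp
  rw [e1]
  linear_combination (Real.exp (-(t / 2)) * t / 2) * e2

theorem divSinh_le_one {t : ℝ} (ht : 0 < t) : divSinh t ≤ 1 :=
  div_le_one_of_le₀ (Real.self_le_sinh_iff.2 (by linarith))
    (Real.sinh_nonneg_iff.2 (by linarith))

theorem one_le_toddFun {t : ℝ} (ht : 0 < t) : 1 ≤ toddFun t := by
  rw [toddFun, one_le_div (one_sub_exp_neg_pos ht)]
  linarith [Real.add_one_le_exp (-t)]

theorem toddFun_pow_le {t : ℝ} (ht : 0 < t) (n : ℕ) :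
    toddFun t ^ n ≤ Real.exp (n / 2 * t) := by
  have h : toddFun t ≤ Real.exp (t / 2) := by
    rw [toddFun_eq ht]
    exact mul_le_of_le_one_right (Real.exp_nonneg _) (divSinh_le_one ht)
  refine (pow_le_pow_left₀ (zero_le_one.trans (one_le_toddFun ht)) h n).trans_eq ?_
  rw [← Real.exp_nat_mul]
  congr 1
  ring

theorem exp_mul_toddFun_pow_nonneg (x : ℝ) {t : ℝ} (ht : 0 < t) (n : ℕ) :
    0 ≤ Real.exp (-x * t) * toddFun t ^ n :=
  mul_nonneg (Real.exp_nonneg _) (pow_nonneg (zero_le_one.trans (one_le_toddFun ht)) n)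

theorem exp_mul_toddFun_pow_le (x : ℝ) {t : ℝ} (ht : 0 < t) (n : ℕ) :
    Real.exp (-x * t) * toddFun t ^ n ≤ Real.exp (-(x - n / 2) * t) := by
  refine (mul_le_mul_of_nonneg_left (toddFun_pow_le ht n) (Real.exp_nonneg _)).trans_eq ?_
  rw [← Real.exp_add]
  congr 1
  ring

@[fun_prop]
theorem measurable_toddFun : Measurable toddFun := by
  unfold toddFun
  fun_prop

/-- The Riccati form, polynomial in the function itself, is what yields a recursion in the exponent.
-/
theorem hasDerivAt_toddFun {t : ℝ} (ht : 0 < t) :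
    HasDerivAt toddFun (((1 + t) * toddFun t - toddFun t ^ 2) / t) t := by
  have h0 := one_sub_exp_neg_pos ht
  have h := (hasDerivAt_id t).div ((hasDerivAt_neg t).exp.const_sub 1) h0.ne'
  refine h.congr_deriv ?_
  rw [toddFun]
  simp only [id_eq]
  field_simp
  ring

/-- The Laplace transform of the `n`-th power of `t / (1 - e⁻ᵗ)`. -/
noncomputable def toddLaplace (n : ℕ) (x : ℝ) : ℝ :=
  ∫ t in Ioi (0 : ℝ), Real.exp (-x * t) * toddFun t ^ n

theorem integrableOn_toddLaplace {n : ℕ} {x : ℝ} (hx : (n : ℝ) / 2 < x) :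
    IntegrableOn (fun t => Real.exp (-x * t) * toddFun t ^ n) (Ioi 0) := by
  refine (integrableOn_exp_mul_Ioi (a := -(x - n / 2)) (by linarith) 0).mono' (by fun_prop) ?_
  refine (ae_restrict_iff' measurableSet_Ioi).2 (ae_of_all _ fun t ht => ?_)
  rw [Real.norm_of_nonneg (exp_mul_toddFun_pow_nonneg x ht n)]
  exact exp_mul_toddFun_pow_le x ht n

theorem integrableOn_mul_exp_neg_mul {a : ℝ} (ha : 0 < a) :
    IntegrableOn (fun t : ℝ => t * Real.exp (-a * t)) (Ioi 0) := by
  have h := integrableOn_rpow_mul_exp_neg_mul_rpow (s := 1) (p := 1) (b := a) (by norm_num) one_pos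
    ha
  simpa using h

theorem integral_exp_neg_mul {a : ℝ} (ha : 0 < a) :
    ∫ t in Ioi (0 : ℝ), Real.exp (-a * t) = 1 / a := by
  rw [integral_exp_mul_Ioi (by linarith)]
  simp

theorem one_div_le_toddLaplace {n : ℕ} {x : ℝ} (hx : (n : ℝ) / 2 < x) :
    1 / x ≤ toddLaplace n x := by
  have hx0 : 0 < x := lt_of_le_of_lt (by positivity) hx
  rw [← integral_exp_neg_mul hx0]
  refine setIntegral_mono_on (integrableOn_exp_mul_Ioi (by linarith) 0)
    (integrableOn_toddLaplace hx) measurableSet_Ioi fun t ht => ?_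
  exact le_mul_of_one_le_right (Real.exp_nonneg _) (one_le_pow₀ (one_le_toddFun ht))

theorem toddLaplace_le {n : ℕ} {x : ℝ} (hx : (n : ℝ) / 2 < x) :
    toddLaplace n x ≤ 1 / (x - n / 2) := by
  rw [← integral_exp_neg_mul (by linarith)]
  exact setIntegral_mono_on (integrableOn_toddLaplace hx)
    (integrableOn_exp_mul_Ioi (by linarith) 0) measurableSet_Ioi
    fun t ht => exp_mul_toddFun_pow_le x ht n

theorem tendsto_inv_sub_const (c : ℝ) : Tendsto (fun x : ℝ => 1 / (x - c)) atTop (𝓝 0) := by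
  simp_rw [one_div]
  exact tendsto_inv_atTop_zero.comp (tendsto_atTop_add_const_right _ (-c) tendsto_id)

theorem tendsto_toddLaplace (n : ℕ) : Tendsto (toddLaplace n) atTop (𝓝 0) := by
  refine tendsto_of_tendsto_of_tendsto_of_le_of_le' (by simpa only [sub_zero] using tendsto_inv_sub_const 0)
    (tendsto_inv_sub_const (n / 2)) ?_ ?_ <;>
    filter_upwards [eventually_gt_atTop ((n : ℝ) / 2)] with x hx
  exacts [one_div_le_toddLaplace hx, toddLaplace_le hx]

theorem tendsto_mul_toddLaplace (n : ℕ) :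
    Tendsto (fun x => x * toddLaplace n x) atTop (𝓝 1) := by
  have h : Tendsto (fun x : ℝ => 1 + n / 2 * (1 / (x - n / 2))) atTop (𝓝 1) := by
    simpa using ((tendsto_inv_sub_const (n / 2)).const_mul ((n : ℝ) / 2)).const_add 1
  refine tendsto_of_tendsto_of_tendsto_of_le_of_le' tendsto_const_nhds h ?_ ?_ <;>
    filter_upwards [eventually_gt_atTop ((n : ℝ) / 2)] with x hx <;>
    have hx0 : 0 < x := lt_of_le_of_lt (by positivity) hx
  · have := mul_le_mul_of_nonneg_left (one_div_le_toddLaplace hx) hx0.le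
    rwa [mul_one_div_cancel hx0.ne'] at this
  · refine (mul_le_mul_of_nonneg_left (toddLaplace_le hx) hx0.le).trans_eq ?_
    have : x - n / 2 ≠ 0 := by linarith
    generalize (n : ℝ) / 2 = c at *
    field_simp
    ring

theorem hasDerivAt_toddLaplace_aux {n : ℕ} {x : ℝ} (hx : (n : ℝ) / 2 < x) :
    IntegrableOn (fun t => -t * (Real.exp (-x * t) * toddFun t ^ n)) (Ioi 0) ∧
    HasDerivAt (toddLaplace n)
      (∫ t in Ioi (0 : ℝ), -t * (Real.exp (-x * t) * toddFun t ^ n)) x := by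
  -- Half the distance to the abscissa `n/2`: every `c > x - a` still satisfies `c - n/2 > a`.
  set a := (x - n / 2) / 2 with ha
  refine hasDerivAt_integral_of_dominated_loc_of_deriv_le (s := Ioi (x - a))
    (F := fun x t => Real.exp (-x * t) * toddFun t ^ n)
    (F' := fun x t => -t * (Real.exp (-x * t) * toddFun t ^ n))
    (bound := fun t => t * Real.exp (-a * t)) (Ioi_mem_nhds (by linarith)) ?_
    (integrableOn_toddLaplace hx) (by fun_prop) ?_
    (integrableOn_mul_exp_neg_mul (by linarith)) ?_
  · exact Eventually.of_forall fun c => by fun_prop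
  · refine (ae_restrict_iff' measurableSet_Ioi).2 (ae_of_all _ fun t ht c hc => ?_)
    have hc : x - a < c := hc
    have ht : 0 < t := ht
    rw [norm_mul, norm_neg, Real.norm_of_nonneg ht.le,
      Real.norm_of_nonneg (exp_mul_toddFun_pow_nonneg c ht n)]
    refine mul_le_mul_of_nonneg_left ((exp_mul_toddFun_pow_le c ht n).trans ?_) ht.le
    exact Real.exp_le_exp.2 (mul_le_mul_of_nonneg_right (by linarith) ht.le)
  · refine ae_of_all _ fun t c _ => ?_
    have h := ((hasDerivAt_neg c).mul_const t).exp.mul_const (toddFun t ^ n)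
    exact h.congr_deriv (by ring)

theorem hasDerivAt_toddLaplace {n : ℕ} {x : ℝ} (hx : (n : ℝ) / 2 < x) :
    HasDerivAt (toddLaplace n) (deriv (toddLaplace n) x) x :=
  (hasDerivAt_toddLaplace_aux hx).2.differentiableAt.hasDerivAt

theorem tendsto_mul_exp_neg_mul {a : ℝ} (ha : 0 < a) :
    Tendsto (fun t : ℝ => t * Real.exp (-a * t)) atTop (𝓝 0) := by
  simpa using tendsto_rpow_mul_exp_neg_mul_atTop_nhds_zero 1 a ha

/-- Integrate the derivative of `t e^{-xt} T^n`, expanded by the Riccati equation; both boundary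
values vanish. -/
theorem toddLaplace_succ {n : ℕ} {x : ℝ} (hx : ((n + 1 : ℕ) : ℝ) / 2 < x) :
    n * toddLaplace (n + 1) x =
      (n + 1) * toddLaplace n x + (x - n) * deriv (toddLaplace n) x := by
  have hx' : (n : ℝ) / 2 < x := by push_cast at hx; linarith
  obtain ⟨hi, hd⟩ := hasDerivAt_toddLaplace_aux hx'
  have hle : ∀ t : ℝ, 0 ≤ t → ‖t * (Real.exp (-x * t) * toddFun t ^ n)‖ ≤
      t * Real.exp (-(x - n / 2) * t) := by
    intro t ht
    rcases ht.eq_or_lt with rfl | ht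
    · simp
    rw [norm_mul, Real.norm_of_nonneg ht.le,
      Real.norm_of_nonneg (exp_mul_toddFun_pow_nonneg x ht n)]
    exact mul_le_mul_of_nonneg_left (exp_mul_toddFun_pow_le x ht n) ht.le
  have h := integral_Ioi_of_hasDerivAt_of_tendsto (a := 0) (m := 0)
    (f := fun t => t * (Real.exp (-x * t) * toddFun t ^ n))
    (f' := fun t => (n + 1) * (Real.exp (-x * t) * toddFun t ^ n) +
      (x - n) * (-t * (Real.exp (-x * t) * toddFun t ^ n)) -
      n * (Real.exp (-x * t) * toddFun t ^ (n + 1))) ?_ ?_ ?_ ?_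
  · have i1 := (integrableOn_toddLaplace hx').const_mul ((n : ℝ) + 1)
    have i2 := hi.const_mul (x - n)
    have i3 := (integrableOn_toddLaplace hx).const_mul (n : ℝ)
    have i12 : IntegrableOn (fun t => ((n : ℝ) + 1) * (Real.exp (-x * t) * toddFun t ^ n) +
        (x - n) * (-t * (Real.exp (-x * t) * toddFun t ^ n))) (Ioi 0) := i1.add i2
    rw [integral_sub i12 i3, integral_add i1 i2, integral_const_mul, integral_const_mul,
      integral_const_mul, ← hd.deriv] at h
    unfold toddLaplace at h ⊢
    linarith
  · rw [ContinuousWithinAt, zero_mul]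
    refine squeeze_zero_norm' (a := fun t => t * Real.exp (-(x - n / 2) * t))
      (eventually_mem_nhdsWithin.mono hle) ?_
    have : Continuous fun t => t * Real.exp (-(x - n / 2) * t) := by fun_prop
    simpa using (this.tendsto 0).mono_left nhdsWithin_le_nhds
  · intro t ht
    have ht : 0 < t := ht
    have h1 := (((hasDerivAt_id t).const_mul (-x)).exp.mul ((hasDerivAt_toddFun ht).pow n))
    have h2 := (hasDerivAt_id t).mul h1
    refine h2.congr_deriv ?_
    -- The derivative of the power contains the truncated exponent `n - 1`.
    rcases n with _ | n
    · simp
      ring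
    · simp
      field_simp
      ring
  · exact (((integrableOn_toddLaplace hx').const_mul ((n : ℝ) + 1)).add
      (hi.const_mul (x - n))).sub ((integrableOn_toddLaplace hx).const_mul (n : ℝ))
  · exact squeeze_zero_norm' (eventually_ge_atTop 0 |>.mono hle)
      (tendsto_mul_exp_neg_mul (by linarith))

/-! ### Identification of functions by their behaviour at infinity -/

theorem eq_of_hasDerivAt_zero_of_tendsto {g : ℝ → ℝ} {c l : ℝ}
    (hg : ∀ x, c < x → HasDerivAt g 0 x) (hl : Tendsto g atTop (𝓝 l)) {x : ℝ} (hx : c < x) :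
    g x = l := by
  have hconst : ∀ y, c < y → g y = g x := fun y hy =>
    isOpen_Ioi.is_const_of_deriv_eq_zero (s := Ioi c) isPreconnected_Ioi
      (fun z hz => (hg z hz).differentiableAt.differentiableWithinAt)
      (fun z hz => (hg z hz).deriv) hy hx
  exact tendsto_nhds_unique (tendsto_const_nhds.congr'
    ((eventually_gt_atTop c).mono fun y hy => (hconst y hy).symm)) hl

theorem eq_of_add_one_of_tendsto {g : ℝ → ℝ} {c l : ℝ} (hg : ∀ x, c < x → g (x + 1) = g x)
    (hl : Tendsto g atTop (𝓝 l)) {x : ℝ} (hx : c < x) : g x = l := by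
  have h : ∀ n : ℕ, g (x + n) = g x := by
    intro n
    induction n with
    | zero => simp
    | succ n ih =>
      have hn : c < x + n := lt_of_lt_of_le hx (by simp)
      rw [← ih, ← hg _ hn]
      push_cast
      ring_nf
  have ht : Tendsto (fun n : ℕ => g (x + n)) atTop (𝓝 l) :=
    hl.comp (tendsto_atTop_add_const_left _ x tendsto_natCast_atTop_atTop)
  simp_rw [h] at ht
  exact tendsto_nhds_unique tendsto_const_nhds ht

theorem tendsto_log_add_const_sub_log (c : ℝ) :
    Tendsto (fun x : ℝ => Real.log (x + c) - Real.log x) atTop (𝓝 0) :=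
  Real.tendsto_log_comp_add_sub_log c

/-! ### Digamma: smoothness, difference equation, asymptotics -/

theorem contDiffAt_Gamma {n : WithTop ℕ∞} {x : ℝ} (hx : 0 < x) :
    ContDiffAt ℝ n Real.Gamma x := by
  have hopen : IsOpen {z : ℂ | 0 < z.re} := isOpen_lt continuous_const Complex.continuous_re
  have h : AnalyticAt ℂ Complex.Gamma (x : ℂ) := by
    refine DifferentiableOn.analyticAt (s := {z : ℂ | 0 < z.re}) (fun z hz => ?_)
      (hopen.mem_nhds (by simpa))
    refine (Complex.differentiableAt_Gamma z fun m hm => ?_).differentiableWithinAt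
    have hz : 0 < z.re := hz
    rw [hm] at hz
    simp at hz
    linarith [(Nat.cast_nonneg m : (0 : ℝ) ≤ m)]
  exact h.contDiffAt.real_of_complex

theorem contDiffAt_realDigamma (n : ℕ) {x : ℝ} (hx : 0 < x) :
    ContDiffAt ℝ n realDigamma x := by
  have h1 : ContDiffAt ℝ (n + 1) Real.Gamma x := contDiffAt_Gamma hx
  have h2 : ContDiffAt ℝ n (deriv Real.Gamma) x := h1.derivWithin le_rfl
  exact h2.div (contDiffAt_Gamma hx) (Real.Gamma_pos_of_pos hx).ne'

theorem realDigamma_add_one {x : ℝ} (hx : 0 < x) : realDigamma (x + 1) = realDigamma x + 1 / x := by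
  have h0 : ∀ m : ℕ, x ≠ -m := fun m => by linarith [(Nat.cast_nonneg m : (0 : ℝ) ≤ m)] |> ne_of_gt
  have h1 : ∀ m : ℕ, x + 1 ≠ -m := fun m =>
    ne_of_gt (by linarith [(Nat.cast_nonneg m : (0 : ℝ) ≤ m)])
  have h := Complex.digamma_apply_add_one x fun m => by exact_mod_cast h0 m
  rw [← ofReal_realDigamma h0, ← Complex.ofReal_one, ← Complex.ofReal_add,
    ← ofReal_realDigamma h1] at h
  rw [one_div]
  exact_mod_cast h

theorem log_Gamma_add_one_sub_log_Gamma {x : ℝ} (hx : 0 < x) :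
    slope (Real.log ∘ Real.Gamma) x (x + 1) = Real.log x := by
  rw [slope_def_field, Function.comp_apply, Function.comp_apply, Real.Gamma_add_one hx.ne',
    Real.log_mul hx.ne' (Real.Gamma_pos_of_pos hx).ne']
  ring

/-- Convexity of `log Γ` puts `ψ(x)` between its slopes over `[x - 1, x]` and `[x, x + 1]`, which
are `log (x - 1)` and `log x`. -/
theorem tendsto_realDigamma_sub_log :
    Tendsto (fun x => realDigamma x - Real.log x) atTop (𝓝 0) := by
  have hne : ∀ {x : ℝ}, 0 < x → ∀ m : ℕ, x ≠ -m := fun hx m =>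
    ne_of_gt (by linarith [(Nat.cast_nonneg m : (0 : ℝ) ≤ m)])
  have hd : ∀ {x : ℝ}, 0 < x → DifferentiableAt ℝ (Real.log ∘ Real.Gamma) x := fun hx =>
    (Real.differentiableAt_Gamma (hne hx)).log (Real.Gamma_ne_zero (hne hx))
  refine tendsto_of_tendsto_of_tendsto_of_le_of_le' (tendsto_log_add_const_sub_log (-1))
    tendsto_const_nhds ?_ ?_ <;>
    filter_upwards [eventually_gt_atTop 1] with x hx <;>
    have hx0 : 0 < x := by linarith
  · have h := Real.convexOn_log_Gamma.slope_le_deriv (x := x + -1) (y := x) (by simpa using hx) hx0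
      (by linarith) (hd hx0)
    have e := log_Gamma_add_one_sub_log_Gamma (x := x + -1) (by linarith)
    rw [neg_add_cancel_right] at e
    rw [e] at h
    rw [realDigamma_eq_deriv_log (hne hx0)]
    exact sub_le_sub_right h _
  · have h := Real.convexOn_log_Gamma.deriv_le_slope (x := x) (y := x + 1) hx0
      (by simp; linarith) (by linarith) (hd hx0)
    rw [log_Gamma_add_one_sub_log_Gamma hx0] at h
    rw [realDigamma_eq_deriv_log (hne hx0)]
    exact sub_nonpos.2 h

/-! ### Recursion for the potentials -/

/-- The primitive of `toddLaplace (n + 1)` asymptotic to `log`. -/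
noncomputable def toddPotential (n : ℕ) (x : ℝ) : ℝ := logPotential n (x - ((n + 1 : ℕ) : ℝ) / 2)

theorem hasDerivAt_toddPotential {n : ℕ} {x : ℝ} (hx : ((n + 1 : ℕ) : ℝ) / 2 < x) :
    HasDerivAt (toddPotential n) (toddLaplace (n + 1) x) x := by
  have h := (hasDerivAt_logPotential n (sub_pos.2 hx)).comp x
    ((hasDerivAt_id x).sub_const (((n + 1 : ℕ) : ℝ) / 2))
  refine h.congr_deriv ?_
  rw [mul_one]
  refine setIntegral_congr_fun measurableSet_Ioi fun t ht => ?_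
  rw [toddFun_eq ht, mul_pow, ← mul_assoc, ← Real.exp_nat_mul, ← Real.exp_add]
  congr 2
  ring

theorem tendsto_toddPotential_sub_log (n : ℕ) :
    Tendsto (fun x => toddPotential n x - Real.log x) atTop (𝓝 0) := by
  have h1 := (tendsto_logPotential_sub_log n).comp
    (tendsto_atTop_add_const_right atTop (-(((n + 1 : ℕ) : ℝ) / 2)) tendsto_id)
  have h2 := tendsto_log_add_const_sub_log (-(((n + 1 : ℕ) : ℝ) / 2))
  rw [← add_zero (0 : ℝ)]
  refine (h1.add h2).congr fun x => ?_
  simp only [toddPotential, Function.comp_apply, id_eq, sub_eq_add_neg]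
  ring

theorem tendsto_toddPotential_add_one_sub (n : ℕ) :
    Tendsto (fun x => toddPotential n (x + 1) - toddPotential n x) atTop (𝓝 0) := by
  have h1 := tendsto_toddPotential_sub_log n
  have h2 := h1.comp (tendsto_atTop_add_const_right atTop (1 : ℝ) tendsto_id)
  have h := (h2.sub h1).add (tendsto_log_add_const_sub_log 1)
  rw [sub_zero, add_zero] at h
  refine h.congr fun x => ?_
  simp only [Function.comp_apply, id_eq]
  ring

theorem toddLaplace_zero {x : ℝ} (hx : 0 < x) : toddLaplace 0 x = 1 / x := by
  simp_rw [toddLaplace, pow_zero, mul_one]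
  exact integral_exp_neg_mul hx

/-- Shifting `x` by one multiplies the integrand by `e^{-t}`, and `(e^{-t} - 1) T(t) = -t`.
Integrated in `x`, this is the difference equation of `ψ`. -/
theorem toddLaplace_one_add_one_sub {x : ℝ} (hx : 1 / 2 < x) :
    toddLaplace 1 (x + 1) - toddLaplace 1 x = deriv (toddLaplace 0) x := by
  have h0 : ((0 : ℕ) : ℝ) / 2 < x := by simp; linarith
  rw [(hasDerivAt_toddLaplace_aux h0).2.deriv, toddLaplace, toddLaplace, ← integral_sub
    (integrableOn_toddLaplace (by push_cast; linarith)) (integrableOn_toddLaplace (by simpa using hx))]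
  refine setIntegral_congr_fun measurableSet_Ioi fun t ht => ?_
  have h := (one_sub_exp_neg_pos ht).ne'
  have e : Real.exp (-(x + 1) * t) = Real.exp (-x * t) * Real.exp (-t) := by
    rw [← Real.exp_add]; congr 1; ring
  simp only [e, toddFun, pow_one, pow_zero]
  field_simp
  ring

theorem toddPotential_zero_add_one {x : ℝ} (hx : 1 / 2 < x) :
    toddPotential 0 (x + 1) = toddPotential 0 x + 1 / x := by
  have h := eq_of_hasDerivAt_zero_of_tendsto (c := 1 / 2) (l := 0 - 0)
    (g := fun x => toddPotential 0 (x + 1) - toddPotential 0 x - toddLaplace 0 x) (fun y hy => ?_)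
    ((tendsto_toddPotential_add_one_sub 0).sub (tendsto_toddLaplace 0)) hx
  · simp only [toddLaplace_zero (show 0 < x by linarith)] at h
    linarith
  · have h1 := (hasDerivAt_toddPotential (n := 0) (x := y + 1)
      (by push_cast; linarith)).comp_add_const y 1
    have h2 := hasDerivAt_toddPotential (n := 0) (x := y) (by simpa using hy)
    have h3 := hasDerivAt_toddLaplace (n := 0) (x := y) (by simp; linarith)
    refine ((h1.sub h2).sub h3).congr_deriv ?_
    rw [← toddLaplace_one_add_one_sub hy, zero_add, sub_self]

theorem toddPotential_zero {x : ℝ} (hx : 1 / 2 < x) : toddPotential 0 x = realDigamma x := by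
  have h := eq_of_add_one_of_tendsto (c := 1 / 2) (l := 0 - 0)
    (g := fun x => toddPotential 0 x - realDigamma x) (fun y hy => ?_)
    (((tendsto_toddPotential_sub_log 0).sub tendsto_realDigamma_sub_log).congr fun x => by ring) hx
  · linarith
  · rw [toddPotential_zero_add_one hy, realDigamma_add_one (by linarith)]
    ring

/-- By `toddLaplace_succ` the two sides have equal derivatives. The constant `-1/(n + 1)` appears
because `x L_{n+1}(x) → 1` while the logarithms cancel. -/
theorem toddPotential_succ {n : ℕ} {x : ℝ} (hx : ((n + 2 : ℕ) : ℝ) / 2 < x) :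
    toddPotential (n + 1) x = toddPotential n x +
      (x - (n + 1)) / (n + 1) * toddLaplace (n + 1) x - 1 / (n + 1) := by
  have hn : (0 : ℝ) < n + 1 := by positivity
  have hlim : Tendsto (fun x => toddPotential (n + 1) x - toddPotential n x -
      (x - (n + 1)) / (n + 1) * toddLaplace (n + 1) x) atTop (𝓝 (-(1 / (n + 1)))) := by
    have h := ((tendsto_toddPotential_sub_log (n + 1)).sub (tendsto_toddPotential_sub_log n)).sub
      (((tendsto_mul_toddLaplace (n + 1)).const_mul (1 / ((n : ℝ) + 1))).sub
        (tendsto_toddLaplace (n + 1)))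
    have e : -(1 / ((n : ℝ) + 1)) = 0 - 0 - (1 / ((n : ℝ) + 1) * 1 - 0) := by ring
    rw [e]
    refine h.congr fun y => ?_
    field_simp
    ring
  have h := eq_of_hasDerivAt_zero_of_tendsto (c := ((n + 2 : ℕ) : ℝ) / 2) (fun y hy => ?_) hlim hx
  · linarith
  · have hy' : ((n + 1 : ℕ) : ℝ) / 2 < y := by push_cast at hy ⊢; linarith
    have h1 := hasDerivAt_toddPotential (n := n + 1) hy
    have h2 := hasDerivAt_toddPotential (n := n) hy'
    have h3 := (((hasDerivAt_id y).sub_const ((n : ℝ) + 1)).div_const ((n : ℝ) + 1)).mul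
      (hasDerivAt_toddLaplace hy')
    refine ((h1.sub h2).sub h3).congr_deriv ?_
    have h4 := toddLaplace_succ (n := n + 1) hy
    push_cast at h4
    simp only [id_eq]
    field_simp
    linear_combination h4

/-! ### Leibniz rule, binomials and the closed form -/

theorem iteratedDeriv_sub_const_add_two (c : ℝ) (i : ℕ) (x : ℝ) :
    iteratedDeriv (i + 2) (fun t : ℝ => t - c) x = 0 := by
  have h : deriv (fun t : ℝ => t - c) = fun _ => 1 := by
    ext t
    simp
  rw [iteratedDeriv_succ', h, iteratedDeriv_succ', deriv_const', iteratedDeriv_fun_const_zero]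

theorem iteratedDeriv_sub_const_mul {n : ℕ} {h : ℝ → ℝ} {c x : ℝ}
    (hh : ContDiffAt ℝ (n + 1 : ℕ) h x) :
    iteratedDeriv (n + 1) (fun t => (t - c) * h t) x =
      (x - c) * iteratedDeriv (n + 1) h x + (n + 1) * iteratedDeriv n h x := by
  have h1 := iteratedDeriv_mul (n := n + 1) (f := fun t : ℝ => t - c) (g := h) (x := x)
    (by fun_prop) hh
  change iteratedDeriv (n + 1) (fun t => (t - c) * h t) x = _ at h1
  rw [h1, Finset.sum_range_succ', Finset.sum_range_succ',
    Finset.sum_eq_zero fun i _ => by rw [iteratedDeriv_sub_const_add_two]; ring]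
  simp [iteratedDeriv_one]
  ring

theorem choose_sub_one_eq_prod (n : ℕ) (t : ℝ) :
    Ring.choose (t - 1) n = (n.factorial : ℝ)⁻¹ * ∏ i ∈ Finset.range n, (t - (i + 1)) := by
  rw [Ring.choose_eq_smul, smul_eq_mul]
  congr 1
  induction n with
  | zero => simp
  | succ n ih =>
    rw [descPochhammer_succ_right, Polynomial.smeval_mul, ih, Finset.prod_range_succ,
      Polynomial.smeval_sub, Polynomial.smeval_X, Polynomial.smeval_natCast]
    simp only [npow_one, npow_zero, nsmul_eq_mul, mul_one]
    ring

theorem choose_sub_one_succ (n : ℕ) (t : ℝ) :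
    Ring.choose (t - 1) (n + 1) = (t - (n + 1)) * Ring.choose (t - 1) n / (n + 1) := by
  have hn : (n : ℝ) + 1 ≠ 0 := by positivity
  have hf : (n.factorial : ℝ) ≠ 0 := by positivity
  rw [choose_sub_one_eq_prod, choose_sub_one_eq_prod, Finset.prod_range_succ, Nat.factorial_succ]
  push_cast
  field_simp

theorem contDiff_choose_sub_one (n : ℕ) {k : WithTop ℕ∞} :
    ContDiff ℝ k fun t : ℝ => Ring.choose (t - 1) n := by
  simp_rw [choose_sub_one_eq_prod]
  exact contDiff_const.mul (contDiff_prod fun i _ => by fun_prop)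

theorem contDiffAt_choose_mul_realDigamma (n k : ℕ) {c x : ℝ} (hx : c < x) :
    ContDiffAt ℝ k (fun t : ℝ => Ring.choose (t - 1) n * realDigamma (t - c)) x :=
  (contDiff_choose_sub_one n).contDiffAt.mul
    ((contDiffAt_realDigamma k (sub_pos.2 hx)).comp x (by fun_prop))

/-- The new binomial factor `(t - (n + 1))/(n + 1)` produces, by Leibniz, exactly the two function
terms of `toddPotential_succ`. Writing `t - 0` matches the shifted form used below. -/
theorem toddPotential_eq (n : ℕ) {x : ℝ} (hx : ((n + 1 : ℕ) : ℝ) / 2 < x) :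
    toddPotential n x = -(harmonic n : ℝ) +
      iteratedDeriv n (fun t : ℝ => Ring.choose (t - 1) n * realDigamma (t - 0)) x := by
  induction n generalizing x with
  | zero =>
    rw [toddPotential_zero (by simpa using hx)]
    simp
  | succ n ih =>
    have hx' : ((n + 1 : ℕ) : ℝ) / 2 < x := by push_cast at hx ⊢; linarith
    have hx0 : 0 < x := lt_of_le_of_lt (by positivity) hx
    have hd : toddLaplace (n + 1) x = iteratedDeriv (n + 1)
        (fun t : ℝ => Ring.choose (t - 1) n * realDigamma (t - 0)) x := by
      rw [← (hasDerivAt_toddPotential hx').deriv, EventuallyEq.deriv_eq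
        ((eventually_gt_nhds hx').mono fun y hy => ih hy), deriv_const_add, iteratedDeriv_succ]
    have hfun : (fun t : ℝ => Ring.choose (t - 1) (n + 1) * realDigamma (t - 0)) = fun t =>
        (t - (n + 1)) * (Ring.choose (t - 1) n * realDigamma (t - 0)) / (n + 1) := by
      ext t
      rw [choose_sub_one_succ]
      ring
    rw [toddPotential_succ hx, ih hx', hd, hfun, iteratedDeriv_div_const,
      iteratedDeriv_sub_const_mul (contDiffAt_choose_mul_realDigamma n (n + 1) hx0), harmonic_succ]
    push_cast
    field_simp
    ring

/-! ### Shifting the digamma argument -/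

theorem iteratedDeriv_polynomial_eval (P : Polynomial ℝ) (n : ℕ) :
    iteratedDeriv n (fun t => P.eval t) = fun t => (Polynomial.derivative^[n] P).eval t := by
  induction n with
  | zero => simp
  | succ n ih =>
    rw [iteratedDeriv_succ, ih, Function.iterate_succ_apply']
    ext t
    exact Polynomial.deriv _

theorem exists_polynomial_choose_div {n m : ℕ} (hm : m < n) :
    ∃ P : Polynomial ℝ, P.natDegree < n ∧
      ∀ t : ℝ, Ring.choose (t - 1) n = P.eval t * (t - (m + 1)) := by
  refine ⟨Polynomial.C (n.factorial : ℝ)⁻¹ *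
    ∏ i ∈ (Finset.range n).erase m, (Polynomial.X - Polynomial.C ((i : ℝ) + 1)), ?_, fun t => ?_⟩
  · refine (Polynomial.natDegree_C_mul_le _ _).trans_lt ?_
    rw [Polynomial.natDegree_finsetProd_X_sub_C_eq_card, Finset.card_erase_of_mem
      (Finset.mem_range.2 hm), Finset.card_range]
    omega
  · rw [choose_sub_one_eq_prod, Polynomial.eval_mul, Polynomial.eval_C, Polynomial.eval_prod,
      mul_assoc, ← Finset.prod_erase_mul _ _ (Finset.mem_range.2 hm)]
    simp

/-- Each unit shift changes `ψ` by `1/(t - (m + 1))`; the binomial vanishes at that pole, leaving a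
polynomial of degree below `n`. -/
theorem iteratedDeriv_choose_mul_realDigamma_sub {n m : ℕ} (hm : m ≤ n) {x : ℝ} (hx : (m : ℝ) < x) :
    iteratedDeriv n (fun t : ℝ => Ring.choose (t - 1) n * realDigamma (t - m)) x =
      iteratedDeriv n (fun t : ℝ => Ring.choose (t - 1) n * realDigamma (t - 0)) x := by
  induction m with
  | zero => simp
  | succ m ih =>
    rw [← ih (by omega) (by push_cast at hx; linarith)]
    obtain ⟨P, hP, hc⟩ := exists_polynomial_choose_div (Nat.lt_of_succ_le hm)
    have he : (fun t : ℝ => Ring.choose (t - 1) n * realDigamma (t - m)) =ᶠ[𝓝 x]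
        (fun t : ℝ => Ring.choose (t - 1) n * realDigamma (t - (m + 1 : ℕ))) +
          fun t => P.eval t := by
      filter_upwards [eventually_gt_nhds hx] with t ht
      have ht' : 0 < t - (m + 1 : ℕ) := sub_pos.2 ht
      have h := realDigamma_add_one ht'
      rw [show t - (m + 1 : ℕ) + 1 = t - m by push_cast; ring] at h
      have h2 := hc t
      rw [Pi.add_apply, h, mul_add, add_right_inj, h2, mul_one_div]
      push_cast at ht' ⊢
      exact mul_div_cancel_right₀ _ ht'.ne'
    rw [he.iteratedDeriv_eq n, iteratedDeriv_add (contDiffAt_choose_mul_realDigamma n n hx)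
      (by simpa using (P.contDiff_aeval (𝕜 := ℝ) n).contDiffAt), iteratedDeriv_polynomial_eval,
      Polynomial.iterate_derivative_eq_zero hP]
    simp

/-! ### The theorem -/

theorem mainTheorem3 (ℓ : ℕ) (hℓ : 1 ≤ ℓ) (x : ℝ) (hx : (ℓ : ℝ) / 2 < x)
    (b : ℝ) (hb : b = (x - (ℓ : ℝ) / 2) ^ (-2 : ℤ)) :
    MeasureTheory.IntegrableOn (fun u : ℝ => Real.log (1 + b * u ^ 2) * rho ℓ u) (Set.Ioi 0) ∧
    ContDiffAt ℝ ((ℓ - 1 : ℕ) : WithTop ℕ∞)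
      (fun t : ℝ => Ring.choose (t - 1) (ℓ - 1) * realDigamma (t - ((ℓ / 2 : ℕ) : ℝ))) x ∧
    ∫ u in Set.Ioi (0 : ℝ), Real.log (1 + b * u ^ 2) * rho ℓ u =
      - Real.log |x - (ℓ : ℝ) / 2| - (harmonic (ℓ - 1) : ℝ)
        + iteratedDeriv (ℓ - 1)
            (fun t : ℝ => Ring.choose (t - 1) (ℓ - 1) * realDigamma (t - ((ℓ / 2 : ℕ) : ℝ))) x := by
  obtain ⟨n, rfl⟩ : ∃ n, ℓ = n + 1 := ⟨ℓ - 1, by omega⟩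
  have ha : 0 < x - ((n + 1 : ℕ) : ℝ) / 2 := sub_pos.2 hx
  have hb0 : 0 ≤ b := by rw [hb]; positivity
  have hm : (((n + 1) / 2 : ℕ) : ℝ) < x := lt_of_le_of_lt Nat.cast_div_le (by exact_mod_cast hx)
  rw [Nat.add_sub_cancel]
  refine ⟨(integrable_log_mul_rho hb0 n).integrableOn,
    contDiffAt_choose_mul_realDigamma n n hm, ?_⟩
  have h := logPotential_eq ha n
  rw [← hb, integral_Ioi_log_mul_rho] at h
  have h2 := toddPotential_eq n hx
  rw [toddPotential, h] at h2
  -- The shift is admissible: `⌊(n + 1)/2⌋ ≤ n`, also for `n = 0`.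
  rw [iteratedDeriv_choose_mul_realDigamma_sub (by omega) hm, abs_of_pos ha]
  linarith
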